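/- Let $L$ be a field of characteristic $0$ (for example $L=\mathbb{C}$), let $\epsilon\in L$ be a primitive cube root of unity and put $F=\mathbb{Q}(\epsilon)\subseteq L$. Let $\alpha\in\mathbb{Z}\setminus\{0,1\}$ be cube-free, that is, not divisible by $d^3$ for any integer $d\neq\pm1$, let $\theta=\sqrt[3]{\alpha}\in L$ be any element with $\theta^3=\alpha$, and put $K=F(\theta)\subseteq L$. Let $p,q$ be distinct odd (positive) primes such that the Legendre symbol $\left(\frac{p}{q}\right)$ equals $-1$ and at least one of $p,q$ is congruent to $1$ modulo $4$. Let $H_K(p,q)$ be the generalized quaternion algebra over $K$ with basis $1,i,j,ij$ and relations $i^2=p$, $j^2=q$, $ij=-ji$. Then $H_K(p,q)$ is a division algebra (that is, for all $a,b\in H_K(p,q)$ with $a\neq0$, each of the equations $ax=b$ and $ya=b$ has a unique solution) if and only if $\left(\frac{-3}{p}\right)=1$ or $\left(\frac{-3}{q}\right)=1$. (Legendre symbols take the value $0$ when the upper entry is divisible by the prime.) -/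

import Mathlib

open scoped Quaternion IntermediateField

/-- A nonzero ring `A` is a division algebra if, for all `a b` in `A` with `a ≠ 0`, each of the
equations `a * x = b` and `y * a = b` has a unique solution. -/
def IsDivisionAlgebra (A : Type*) [Ring A] : Prop :=
  Nontrivial A ∧ ∀ a b : A, a ≠ 0 → (∃! x : A, a * x = b) ∧ (∃! y : A, y * a = b)

/-- An integer is cube-free if it is not divisible by the cube of any non-unit (so `0` is not
cube-free, while `1` and `-1` are). -/
def IsCubeFree (n : ℤ) : Prop :=
  ∀ d : ℤ, d ^ 3 ∣ n → IsUnit d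

/-! The algebra is a division algebra iff its norm form is anisotropic, so the question is whether
that form has a nontrivial zero over `K`.

If `-3` is a square mod `p`, Hensel's lemma embeds `F` in `ℚ_p`, where the form is anisotropic
because `q` is a nonresidue mod `p` (`Padic.anisotropicNormForm`). As `K/F` has degree 1 or 3,
anisotropy climbs from `F` to `K` by taking norms (`AnisotropicNormForm.of_odd_finrank`). The case
of `q` is symmetric, by reciprocity.

If neither symbol is 1, a zero exists over any field of characteristic 0 containing `√-3`. When `p`
or `q` is 3, the other prime is a sum of two squares and a zero is explicit. Otherwise `p ≡ q ≡ 2`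
mod 3, the conic `3x² + py² = qz²` has a nontrivial integer point
(`exists_three_mul_sq_add_mul_sq_eq`), and `√-3` turns it into a zero. -/

/-- The norm form `a² - p b² - q c² + p q d²` of the quaternion algebra `ℍ[K, p, q]` is
anisotropic. -/
def AnisotropicNormForm {K : Type*} [Field K] (p q : K) : Prop :=
  ∀ a b c d : K, a ^ 2 - p * b ^ 2 - q * c ^ 2 + p * q * d ^ 2 = 0 →
    a = 0 ∧ b = 0 ∧ c = 0 ∧ d = 0

/-! ### Anisotropy and division algebras. -/

namespace AnisotropicNormForm

variable {K : Type*} [Field K] {p q : K}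

theorem symm (h : AnisotropicNormForm p q) : AnisotropicNormForm q p := by
  intro a b c d habcd
  obtain ⟨ha, hc, hb, hd⟩ := h a c b d (by linear_combination habcd)
  exact ⟨ha, hb, hc, hd⟩

theorem ne_sq (h : AnisotropicNormForm p q) (e : K) : e ^ 2 ≠ p := fun he =>
  one_ne_zero (h e 1 0 0 (by linear_combination he)).2.1

theorem of_map {E : Type*} [Field E] (f : K →+* E) (h : AnisotropicNormForm (f p) (f q)) :
    AnisotropicNormForm p q := by
  intro a b c d habcd
  have := h (f a) (f b) (f c) (f d) (by simpa using congrArg f habcd)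
  simpa using this

end AnisotropicNormForm

theorem isDivisionAlgebra_quaternionAlgebra_iff {K : Type*} [Field K] {p q : K} :
    IsDivisionAlgebra ℍ[K, p, q] ↔ AnisotropicNormForm p q := by
  have key (x : ℍ[K, p, q]) (n : K)
      (hn : n = x.re ^ 2 - p * x.imI ^ 2 - q * x.imJ ^ 2 + p * q * x.imK ^ 2) :
      x * star x = n ∧ star x * x = n := by
    subst hn
    constructor <;> ext <;>
      simp only [QuaternionAlgebra.re_mul, QuaternionAlgebra.imI_mul, QuaternionAlgebra.imJ_mul,
        QuaternionAlgebra.imK_mul, QuaternionAlgebra.re_star, QuaternionAlgebra.imI_star,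
        QuaternionAlgebra.imJ_star, QuaternionAlgebra.imK_star, QuaternionAlgebra.re_coe,
        QuaternionAlgebra.imI_coe, QuaternionAlgebra.imJ_coe, QuaternionAlgebra.imK_coe] <;> ring
  constructor
  · rintro ⟨-, h⟩ a b c d habcd
    by_contra hne
    have hx : (⟨a, b, c, d⟩ : ℍ[K, p, q]) ≠ 0 := by
      intro h0
      rw [QuaternionAlgebra.ext_iff] at h0
      exact hne (by simpa using h0)
    have h1 := (h _ 0 hx).1.unique (mul_zero _) (y₂ := star ⟨a, b, c, d⟩)
      (by rw [(key _ 0 habcd.symm).1, QuaternionAlgebra.coe_zero])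
    exact hx (star_eq_zero.1 h1.symm)
  · intro h
    refine ⟨⟨0, 1, fun h0 => ?_⟩, fun a b ha => ?_⟩
    · simpa using congrArg QuaternionAlgebra.re h0
    set n : K := a.re ^ 2 - p * a.imI ^ 2 - q * a.imJ ^ 2 + p * q * a.imK ^ 2 with hn
    have hn0 : n ≠ 0 := by
      intro h0
      obtain ⟨h1, h2, h3, h4⟩ := h _ _ _ _ h0
      exact ha (by ext <;> simpa)
    have hl : (((n⁻¹ : K) : ℍ[K, p, q]) * star a) * a = 1 := by
      rw [mul_assoc, (key _ _ hn).2, ← QuaternionAlgebra.coe_mul, inv_mul_cancel₀ hn0,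
        QuaternionAlgebra.coe_one]
    have hr : a * (((n⁻¹ : K) : ℍ[K, p, q]) * star a) = 1 := by
      rw [← mul_assoc, ← QuaternionAlgebra.coe_commutes, mul_assoc, (key _ _ hn).1,
        ← QuaternionAlgebra.coe_mul, inv_mul_cancel₀ hn0,
        QuaternionAlgebra.coe_one]
    generalize ((n⁻¹ : K) : ℍ[K, p, q]) * star a = u at hl hr
    refine ⟨⟨u * b, ?_, fun y hy => ?_⟩, ⟨b * u, ?_, fun y hy => ?_⟩⟩
    · simp only [← mul_assoc, hr, one_mul]
    · rw [← hy, ← mul_assoc, hl, one_mul]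
    · simp only [mul_assoc, hl, mul_one]
    · rw [← hy, mul_assoc, hr, mul_one]

/-! ### Anisotropy in extensions of odd degree. -/

/-- With `w = √p`, `A² - pB² = (A + wB)(A - wB)`, and `σ` applied entrywise carries the first factor
to the second. -/
theorem Matrix.map_det_sq_sub_mul_sq {F S n : Type*} [CommRing F] [CommRing S] [Fintype n]
    [DecidableEq n] (f : F →+* S) (σ : S →+* S) {p : F} {w : S} (hw : w * w = f p)
    (hσf : ∀ x, σ (f x) = f x) (hσw : σ w = -w) {A B : Matrix n n F} (hAB : Commute A B) :
    f (A ^ 2 - p • B ^ 2).det =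
      (f.mapMatrix A + w • f.mapMatrix B).det * σ (f.mapMatrix A + w • f.mapMatrix B).det := by
  have hσ : σ.mapMatrix (f.mapMatrix A + w • f.mapMatrix B) =
      f.mapMatrix A - w • f.mapMatrix B := by
    ext i j
    simp [hσf, hσw, sub_eq_add_neg]
  have hsmul : f.mapMatrix (p • B ^ 2) = (w * w) • f.mapMatrix B ^ 2 := by
    rw [hw, ← map_pow]
    ext i j
    simp
  rw [RingHom.map_det, RingHom.map_det, ← Matrix.det_mul, hσ, map_sub, hsmul, map_pow]
  congr 1
  have h1 := (hAB.map f.mapMatrix).eq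
  simp only [add_mul, mul_sub, Matrix.smul_mul, Matrix.mul_smul, h1, smul_smul, sq]
  abel

/-- If `A` and `B` commute, then `det (A² - p B²)` is a norm from `F[√p]`. -/
theorem Matrix.exists_det_sq_sub_mul_sq {F n : Type*} [CommRing F] [Fintype n] [DecidableEq n]
    (p : F) {A B : Matrix n n F} (hAB : Commute A B) :
    ∃ x y : F, (A ^ 2 - p • B ^ 2).det = x ^ 2 - p * y ^ 2 := by
  -- `QuadraticAlgebra F p 0` is `F[X]/(X² - p)`, which serves even when `p` is a square in `F`.
  obtain ⟨z, h⟩ : ∃ z : QuadraticAlgebra F p 0,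
      algebraMap F (QuadraticAlgebra F p 0) (A ^ 2 - p • B ^ 2).det = z * starRingEnd _ z :=
    ⟨_, Matrix.map_det_sq_sub_mul_sq _ _ (w := ⟨0, 1⟩) (by ext <;> simp)
      (fun x => by ext <;> simp [starRingEnd_apply]) (by ext <;> simp [starRingEnd_apply]) hAB⟩
  rw [starRingEnd_apply] at h
  refine ⟨z.re, z.im, ?_⟩
  have := congrArg QuadraticAlgebra.re h
  simp only [QuadraticAlgebra.algebraMap_re, QuadraticAlgebra.re_mul, QuadraticAlgebra.re_star,
    QuadraticAlgebra.im_star] at this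
  rw [this]
  ring

theorem Algebra.exists_norm_sq_sub_mul_sq {F K : Type*} [Field F] [Field K] [Algebra F K]
    [FiniteDimensional F K] (p : F) (a b : K) :
    ∃ x y : F, Algebra.norm F (a ^ 2 - algebraMap F K p * b ^ 2) = x ^ 2 - p * y ^ 2 := by
  classical
  let B := Module.finBasis F K
  obtain ⟨x, y, h⟩ := Matrix.exists_det_sq_sub_mul_sq p
    ((Commute.all a b).map (Algebra.leftMulMatrix B))
  refine ⟨x, y, ?_⟩
  rw [← h, Algebra.norm_eq_matrix_det B, ← Algebra.smul_def]
  simp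

/-- A zero over `K` reads `a² - pb² = q(c² - pd²)`. Taking norms to `F` gives `x² - py² = q^(2m+1)
(u² - pv²)`, and the even power `q^(2m)` is absorbed into `u` and `v`. The same parity argument
shows that `p` does not become a square in `K`. -/
theorem AnisotropicNormForm.of_odd_finrank {F K : Type*} [Field F] [Field K] [Algebra F K]
    (hodd : Odd (Module.finrank F K)) {p q : F} (hp : p ≠ 0) (hq : q ≠ 0)
    (h : AnisotropicNormForm p q) :
    AnisotropicNormForm (algebraMap F K p) (algebraMap F K q) := by
  have : FiniteDimensional F K := Module.finite_of_finrank_pos hodd.pos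
  obtain ⟨m, hm⟩ := hodd
  have hns : ∀ c d : K, c ^ 2 - algebraMap F K p * d ^ 2 = 0 → c = 0 ∧ d = 0 := by
    intro c d hcd
    have hd : d = 0 := by
      by_contra hd
      have h1 : (c / d) ^ 2 = algebraMap F K p := by
        field_simp
        linear_combination hcd
      have h2 := congrArg (Algebra.norm F) h1
      rw [map_pow, Algebra.norm_algebraMap, hm] at h2
      refine h.ne_sq (Algebra.norm F (c / d) / p ^ m) ?_
      field_simp
      rw [h2]
      ring
    subst hd
    simpa using hcd
  intro a b c d habcd
  have h1 : a ^ 2 - algebraMap F K p * b ^ 2 =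
      algebraMap F K q * (c ^ 2 - algebraMap F K p * d ^ 2) := by linear_combination habcd
  by_cases hcd : c ^ 2 - algebraMap F K p * d ^ 2 = 0
  · rw [hcd, mul_zero] at h1
    obtain ⟨rfl, rfl⟩ := hns _ _ h1
    obtain ⟨rfl, rfl⟩ := hns _ _ hcd
    simp
  · exfalso
    obtain ⟨x, y, hxy⟩ := Algebra.exists_norm_sq_sub_mul_sq p a b
    obtain ⟨u, v, huv⟩ := Algebra.exists_norm_sq_sub_mul_sq p c d
    have h2 := congrArg (Algebra.norm F) h1
    rw [map_mul, hxy, huv, Algebra.norm_algebraMap, hm] at h2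
    obtain ⟨-, -, hu, hv⟩ := h x y (q ^ m * u) (q ^ m * v) (by linear_combination h2)
    have hqm : q ^ m ≠ 0 := pow_ne_zero _ hq
    apply (Algebra.norm_ne_zero_iff (R := F)).2 hcd
    rw [huv, (mul_eq_zero.1 hu).resolve_left hqm, (mul_eq_zero.1 hv).resolve_left hqm]
    ring

/-- Either `X³ - a` is irreducible and the degree is 3, or `a` has a cube root in `F`; then all its
cube roots lie in `F`, since `ε` does, and the degree is 1. -/
theorem odd_finrank_adjoin_of_cube_mem {F L : Type*} [Field F] [Field L] [Algebra F L]
    {ε : F} (hε : IsPrimitiveRoot ε 3) {θ : L} {a : F} (hθ : θ ^ 3 = algebraMap F L a) :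
    Odd (Module.finrank F F⟮θ⟯) := by
  by_cases h : ∀ b : F, b ^ 3 ≠ a
  · have hirr := X_pow_sub_C_irreducible_of_prime Nat.prime_three h
    have hmin : minpoly F θ = Polynomial.X ^ 3 - Polynomial.C a :=
      (minpoly.eq_of_irreducible_of_monic hirr (by simp [hθ])
        (Polynomial.monic_X_pow_sub_C a three_ne_zero)).symm
    have hint : IsIntegral F θ := by
      refine ⟨Polynomial.X ^ 3 - Polynomial.C a, Polynomial.monic_X_pow_sub_C a three_ne_zero, ?_⟩
      simp [hθ]
    rw [IntermediateField.adjoin.finrank hint, hmin, Polynomial.natDegree_X_pow_sub_C]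
    decide
  · push Not at h
    obtain ⟨b, rfl⟩ := h
    have hmem : θ ∈ (⊥ : IntermediateField F L) := by
      rw [IntermediateField.mem_bot]
      have hε' := hε.map_of_injective (algebraMap F L).injective
      rw [map_pow] at hθ
      by_cases hb : algebraMap F L b = 0
      · rw [hb, zero_pow three_ne_zero] at hθ
        exact ⟨0, by rw [map_zero, pow_eq_zero_iff three_ne_zero |>.1 hθ]⟩
      · obtain ⟨i, -, hi⟩ := hε'.eq_pow_of_pow_eq_one (ξ := θ / algebraMap F L b)
          (by rw [div_pow, hθ, div_self (pow_ne_zero 3 hb)])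
        refine ⟨ε ^ i * b, ?_⟩
        rw [map_mul, map_pow, hi, div_mul_cancel₀ _ hb]
    rw [IntermediateField.adjoin_simple_eq_bot_iff.2 hmem, IntermediateField.finrank_bot]
    exact odd_one

/-! ### Local anisotropy at `p` and the embedding of `ℚ(ε)` in `ℚ_p`. -/

theorem ZMod.eq_zero_of_sq_eq_mul_sq {p : ℕ} [Fact p.Prime] {q a c : ZMod p} (hq : ¬ IsSquare q)
    (h : a ^ 2 = q * c ^ 2) : a = 0 ∧ c = 0 := by
  have hc : c = 0 := by
    by_contra hc
    refine hq ⟨a / c, ?_⟩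
    field_simp
    linear_combination -h
  subst hc
  simpa using h

theorem PadicInt.exists_eq_mul_of_toZMod_eq_zero {p : ℕ} [Fact p.Prime] {x : ℤ_[p]}
    (h : PadicInt.toZMod x = 0) : ∃ y, x = p * y := by
  rw [← RingHom.mem_ker, PadicInt.ker_toZMod, PadicInt.maximalIdeal_eq_span_p,
    Ideal.mem_span_singleton] at h
  exact h

/-- Reducing mod `p` leaves `a² = qc²`, so `p` divides `a` and `c`; after division by `p` the same
argument applies to `b` and `d`. -/
theorem PadicInt.toZMod_eq_zero_of_norm_form_eq_zero {p q : ℕ} [Fact p.Prime]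
    (hq : ¬ IsSquare (q : ZMod p)) {a b c d : ℤ_[p]}
    (h : a ^ 2 - p * b ^ 2 - q * c ^ 2 + p * q * d ^ 2 = 0) :
    PadicInt.toZMod a = 0 ∧ PadicInt.toZMod b = 0 ∧ PadicInt.toZMod c = 0 ∧
      PadicInt.toZMod d = 0 := by
  obtain ⟨ha, hc⟩ := ZMod.eq_zero_of_sq_eq_mul_sq (a := PadicInt.toZMod a)
    (c := PadicInt.toZMod c) hq (by
      have := congrArg PadicInt.toZMod h
      simp at this
      linear_combination this)
  obtain ⟨a, rfl⟩ := PadicInt.exists_eq_mul_of_toZMod_eq_zero ha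
  obtain ⟨c, rfl⟩ := PadicInt.exists_eq_mul_of_toZMod_eq_zero hc
  have hp : (p : ℤ_[p]) ≠ 0 := by exact_mod_cast (Fact.out : p.Prime).ne_zero
  have h' : b ^ 2 - q * d ^ 2 = p * (a ^ 2 - q * c ^ 2) :=
    mul_left_cancel₀ hp (by linear_combination -h)
  obtain ⟨hb, hd⟩ := ZMod.eq_zero_of_sq_eq_mul_sq (a := PadicInt.toZMod b)
    (c := PadicInt.toZMod d) hq (by
      have := congrArg PadicInt.toZMod h'
      simp at this
      linear_combination this)
  exact ⟨ha, hb, hc, hd⟩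

theorem Padic.anisotropicNormForm {p q : ℕ} [Fact p.Prime] (hq : ¬ IsSquare (q : ZMod p)) :
    AnisotropicNormForm (p : ℚ_[p]) (q : ℚ_[p]) := by
  intro a b c d h
  let v : Fin 4 → ℚ_[p] := ![a, b, c, d]
  -- Dividing by a coordinate of largest norm makes all coordinates integral and one of them 1,
  -- which is nonzero mod `p`.
  obtain ⟨i, hi⟩ := Finite.exists_max fun i => ‖v i‖
  suffices hv : v i = 0 by
    have hz : ∀ j, v j = 0 := fun j => norm_le_zero_iff.1 (by simpa [hv] using hi j)
    exact ⟨hz 0, hz 1, hz 2, hz 3⟩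
  by_contra hv
  have hle : ∀ j, ‖v j / v i‖ ≤ 1 := fun j => by
    rw [norm_div]
    exact div_le_one_of_le₀ (hi j) (norm_nonneg _)
  let w : Fin 4 → ℤ_[p] := fun j => ⟨v j / v i, hle j⟩
  have hw : ∀ j, (w j : ℚ_[p]) = v j / v i := fun j => rfl
  have hform : w 0 ^ 2 - p * w 1 ^ 2 - q * w 2 ^ 2 + p * q * w 3 ^ 2 = 0 := by
    apply PadicInt.ext
    push_cast
    simp only [hw]
    have h4 : v 0 ^ 2 - p * v 1 ^ 2 - q * v 2 ^ 2 + p * q * v 3 ^ 2 = 0 := h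
    field_simp
    linear_combination h4
  obtain ⟨h0, h1, h2, h3⟩ := PadicInt.toZMod_eq_zero_of_norm_form_eq_zero hq hform
  have hz : ∀ j, PadicInt.toZMod (w j) = 0 := by
    intro j
    fin_cases j
    exacts [h0, h1, h2, h3]
  have hone : w i = 1 := PadicInt.ext (by rw [hw, div_self hv, PadicInt.coe_one])
  simpa [hone] using hz i

theorem PadicInt.exists_sq_eq_intCast {p : ℕ} [Fact p.Prime] (hp : p ≠ 2) {a : ℤ}
    (ha : legendreSym p a = 1) : ∃ s : ℤ_[p], s ^ 2 = a := by
  have ha0 : (a : ZMod p) ≠ 0 := fun h0 => by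
    rw [(legendreSym.eq_zero_iff p a).2 h0] at ha
    exact zero_ne_one ha
  obtain ⟨r, hr⟩ := (legendreSym.eq_one_iff p ha0).1 ha
  obtain ⟨n, rfl⟩ := ZMod.intCast_surjective r
  have hdvd : (p : ℤ) ∣ n ^ 2 - a := by
    rw [← ZMod.intCast_zmod_eq_zero_iff_dvd _ p]
    push_cast
    linear_combination -hr
  have hnd : ¬ (p : ℤ) ∣ 2 * n := by
    intro h
    have hpZ : Prime (p : ℤ) := Nat.prime_iff_prime_int.1 Fact.out
    rcases hpZ.dvd_or_dvd h with h | h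
    · have : p ∣ 2 := by exact_mod_cast h
      exact hp ((Nat.prime_dvd_prime_iff_eq Fact.out Nat.prime_two).1 this)
    · rw [← ZMod.intCast_zmod_eq_zero_iff_dvd _ p] at h
      simp [h] at hr
      exact ha0 hr
  have h1 : ‖((n ^ 2 - a : ℤ) : ℤ_[p])‖ < 1 := PadicInt.norm_int_lt_one_iff_dvd _ |>.2 hdvd
  have h2 : ‖((2 * n : ℤ) : ℤ_[p])‖ = 1 := by
    refine le_antisymm (PadicInt.norm_le_one _) (not_lt.1 fun h => hnd ?_)
    exact (PadicInt.norm_int_lt_one_iff_dvd _).1 h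
  have h3 : Polynomial.aeval (n : ℤ_[p]) (Polynomial.X ^ 2 - Polynomial.C a : Polynomial ℤ) =
      ((n ^ 2 - a : ℤ) : ℤ_[p]) := by simp
  have h4 : Polynomial.aeval (n : ℤ_[p])
      (Polynomial.derivative (Polynomial.X ^ 2 - Polynomial.C a : Polynomial ℤ)) =
      ((2 * n : ℤ) : ℤ_[p]) := by
    simp [map_ofNat (Polynomial.aeval (R := ℤ) (n : ℤ_[p])) 2]
  obtain ⟨z, hz, -⟩ := hensels_lemma (p := p) (F := Polynomial.X ^ 2 - Polynomial.C a)
    (a := (n : ℤ_[p])) (by rwa [h3, h4, h2, one_pow])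
  exact ⟨z, by simpa [sub_eq_zero] using hz⟩

theorem exists_ringHom_adjoin_primitiveRoot_three {L E : Type*} [Field L] [CharZero L] [Field E]
    [CharZero E] {ε : L} (hε : IsPrimitiveRoot ε 3) {s : E} (hs : s ^ 2 = -3) :
    Nonempty (ℚ⟮ε⟯ →+* E) := by
  have hint : IsIntegral ℚ ε := (hε.isIntegral (by norm_num)).tower_top
  have hmin : minpoly ℚ ε = Polynomial.X ^ 2 + Polynomial.X + 1 := by
    rw [← Polynomial.cyclotomic_three, Polynomial.cyclotomic_eq_minpoly_rat hε (by norm_num)]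
  refine ⟨((IntermediateField.algHomAdjoinIntegralEquiv ℚ hint).symm
    -- A root in `E` of `X² + X + 1`, by the quadratic formula.
    ⟨(-1 + s) / 2, ?_⟩ : ℚ⟮ε⟯ →ₐ[ℚ] E).toRingHom⟩
  rw [Polynomial.mem_aroots]
  refine ⟨minpoly.ne_zero hint, ?_⟩
  rw [hmin]
  simp
  linear_combination hs / 4

/-! ### An integer point on the conic, by pigeonhole. -/

theorem Int.sq_ne_mul_of_prime {a b : ℕ} (ha : a.Prime) (hb : b.Prime) (hab : a ≠ b) (n : ℤ) :
    n ^ 2 ≠ a * b := by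
  intro h
  have haZ : Prime (a : ℤ) := Nat.prime_iff_prime_int.1 ha
  obtain ⟨m, rfl⟩ := haZ.dvd_of_dvd_pow (h ▸ Dvd.intro _ rfl : (a : ℤ) ∣ n ^ 2)
  have h1 : (b : ℤ) = a * m ^ 2 := mul_left_cancel₀ haZ.ne_zero (by linear_combination -h)
  have h2 : a ∣ b := by exact_mod_cast Dvd.intro _ h1.symm
  exact hab ((Nat.prime_dvd_prime_iff_eq ha hb).1 h2)

/-- A case of Legendre's theorem on the conic `3 x² + p y² = q z²`. -/
theorem exists_three_mul_sq_add_mul_sq_eq {p q : ℕ} (hp : p.Prime) (hq : q.Prime) (hpq : p ≠ q)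
    (hp3 : p ≠ 3) (hq3 : q ≠ 3) {r s : ℤ} (hr : (q : ℤ) ∣ 3 * r ^ 2 + p)
    (hs : (p : ℤ) ∣ 3 * s ^ 2 - q) (h3 : (3 : ℤ) ∣ p - q) :
    ∃ x y z : ℤ, (x ≠ 0 ∨ y ≠ 0 ∨ z ≠ 0) ∧ 3 * x ^ 2 + p * y ^ 2 = q * z ^ 2 := by
  have : NeZero p := ⟨hp.ne_zero⟩
  have : NeZero q := ⟨hq.ne_zero⟩
  -- The box has more than `3pq` points, so two of them agree under `g`. Their difference satisfies
  -- `x ≡ ry` mod `q`, `x ≡ sz` mod `p` and `y ≡ z` mod 3, each of which makes `3x² + py² - qz²`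
  -- vanish for that modulus.
  let A := Nat.sqrt (p * q)
  let B := Nat.sqrt (3 * q)
  let C := Nat.sqrt (3 * p)
  let S := Finset.range (A + 1) ×ˢ Finset.range (B + 1) ×ˢ Finset.range (C + 1)
  let g : ℕ × ℕ × ℕ → ZMod q × ZMod p × ZMod 3 := fun v =>
    ((v.1 : ZMod q) - r * v.2.1, (v.1 : ZMod p) - s * v.2.2, (v.2.1 : ZMod 3) - v.2.2)
  have hcard : (Finset.univ : Finset (ZMod q × ZMod p × ZMod 3)).card < S.card := by
    simp only [S, Finset.card_product, Finset.card_range, Finset.card_univ, Fintype.card_prod,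
      ZMod.card]
    refine lt_of_pow_lt_pow_left₀ 2 (Nat.zero_le _) ?_
    have hA : p * q < (A + 1) ^ 2 := Nat.lt_succ_sqrt' _
    have hB : 3 * q < (B + 1) ^ 2 := Nat.lt_succ_sqrt' _
    have hC : 3 * p < (C + 1) ^ 2 := Nat.lt_succ_sqrt' _
    calc (q * (p * 3)) ^ 2 = (p * q) * ((3 * q) * (3 * p)) := by ring
      _ < (A + 1) ^ 2 * ((B + 1) ^ 2 * (C + 1) ^ 2) := by gcongr
      _ = _ := by ring
  obtain ⟨⟨x₁, y₁, z₁⟩, h₁, ⟨x₂, y₂, z₂⟩, h₂, hne, hg⟩ :=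
    Finset.exists_ne_map_eq_of_card_lt_of_maps_to hcard (f := g) (fun _ _ => Finset.mem_univ _)
  simp only [S, Finset.mem_product, Finset.mem_range, Order.lt_add_one_iff] at h₁ h₂
  simp only [g, Prod.mk.injEq] at hg
  obtain ⟨hgq, hgp, hg3⟩ := hg
  have hsq : ∀ {m a b : ℕ}, a ≤ Nat.sqrt m → b ≤ Nat.sqrt m → ((a : ℤ) - b) ^ 2 ≤ m := by
    intro m a b ha hb
    have h : (Nat.sqrt m : ℤ) ^ 2 ≤ m := by exact_mod_cast Nat.sqrt_le' m
    refine le_trans (sq_le_sq' ?_ ?_) h <;> omega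
  have hx := hsq h₁.1 h₂.1
  have hy := hsq h₁.2.1 h₂.2.1
  have hz := hsq h₁.2.2 h₂.2.2
  have hne' : (x₁ : ℤ) - x₂ ≠ 0 ∨ (y₁ : ℤ) - y₂ ≠ 0 ∨ (z₁ : ℤ) - z₂ ≠ 0 := by
    by_contra! h
    apply hne
    ext <;> simp <;> omega
  have hq' : (q : ℤ) ∣ ((x₁ : ℤ) - x₂) - r * (y₁ - y₂) := by
    rw [← ZMod.intCast_zmod_eq_zero_iff_dvd _ q]
    push_cast
    linear_combination hgq
  have hp' : (p : ℤ) ∣ ((x₁ : ℤ) - x₂) - s * (z₁ - z₂) := by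
    rw [← ZMod.intCast_zmod_eq_zero_iff_dvd _ p]
    push_cast
    linear_combination hgp
  have h3' : ((3 : ℕ) : ℤ) ∣ ((y₁ : ℤ) - y₂) - (z₁ - z₂) := by
    rw [← ZMod.intCast_zmod_eq_zero_iff_dvd _ 3]
    push_cast
    linear_combination hg3
  generalize (x₁ : ℤ) - x₂ = x at *
  generalize (y₁ : ℤ) - y₂ = y at *
  generalize (z₁ : ℤ) - z₂ = z at *
  push_cast at hx hy hz h3'
  replace hx := hx.lt_of_ne (Int.sq_ne_mul_of_prime hp hq hpq x)
  replace hz := hz.lt_of_ne (Int.sq_ne_mul_of_prime Nat.prime_three hp hp3.symm z)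
  have hpqc : IsCoprime (p : ℤ) q := Nat.isCoprime_iff_coprime.2 ((Nat.coprime_primes hp hq).2 hpq)
  have h3p : IsCoprime ((3 : ℕ) : ℤ) p :=
    Nat.isCoprime_iff_coprime.2 ((Nat.coprime_primes Nat.prime_three hp).2 hp3.symm)
  have h3q : IsCoprime ((3 : ℕ) : ℤ) q :=
    Nat.isCoprime_iff_coprime.2 ((Nat.coprime_primes Nat.prime_three hq).2 hq3.symm)
  have hdvd : (3 * (p * q) : ℤ) ∣ 3 * x ^ 2 + p * y ^ 2 - q * z ^ 2 := by
    refine (h3p.mul_right h3q).mul_dvd ?_ (hpqc.mul_dvd ?_ ?_)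
    · obtain ⟨k, hk⟩ := h3
      obtain ⟨l, hl⟩ := h3'
      exact ⟨x ^ 2 + k * y ^ 2 + q * (y + z) * l, by
        push_cast; linear_combination y ^ 2 * hk + q * (y + z) * hl⟩
    · obtain ⟨k, hk⟩ := hs
      obtain ⟨l, hl⟩ := hp'
      exact ⟨y ^ 2 + k * z ^ 2 + 3 * (x + s * z) * l, by
        linear_combination z ^ 2 * hk + 3 * (x + s * z) * hl⟩
    · obtain ⟨k, hk⟩ := hr
      obtain ⟨l, hl⟩ := hq'
      exact ⟨-z ^ 2 + k * y ^ 2 + 3 * (x + r * y) * l, by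
        linear_combination y ^ 2 * hk + 3 * (x + r * y) * hl⟩
  obtain ⟨k, hk⟩ := hdvd
  have hp0 : (0 : ℤ) < p := by exact_mod_cast hp.pos
  have hq0 : (0 : ℤ) < q := by exact_mod_cast hq.pos
  have hpq0 := mul_pos hp0 hq0
  have hy' := mul_le_mul_of_nonneg_left hy hp0.le
  have hz' := mul_lt_mul_of_pos_left hz hq0
  -- From `x² < pq`, `y² ≤ 3q` and `z² < 3p`, the form lies strictly between `-3pq` and `6pq`.
  have hk1 : -1 < k := by
    by_contra! h
    nlinarith [mul_nonneg hp0.le (sq_nonneg y), sq_nonneg x]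
  have hk2 : k < 2 := by
    by_contra! h
    nlinarith [mul_nonneg hq0.le (sq_nonneg z)]
  obtain rfl | rfl : k = 0 ∨ k = 1 := by omega
  · exact ⟨x, y, z, hne', by linear_combination hk⟩
  -- Here `3x² + py² = q(z² + 3p)`. Multiplying by `z² + 3p`, a norm from `ℚ(√(-3p))`, makes the
  -- right side `q(z² + 3p)²` and keeps the left side of the form `3X² + pY²`.
  · refine ⟨x * z + p * y, y * z - 3 * x, z ^ 2 + 3 * p, Or.inr (Or.inr (by positivity)), ?_⟩
    linear_combination (z ^ 2 + 3 * p) * hk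

/-! ### Isotropy over fields containing `√-3`. -/

theorem legendreSym_neg_three {p : ℕ} [Fact p.Prime] (hp : p ≠ 2) :
    legendreSym p (-3) = legendreSym 3 p := by
  rw [legendreSym.at_neg hp]
  have hodd := (Nat.Prime.eq_two_or_odd (Fact.out : p.Prime)).resolve_left hp
  have h3 : ((3 : ℕ) : ℤ) = 3 := rfl
  obtain h | h : p % 4 = 1 ∨ p % 4 = 3 := by omega
  · rw [ZMod.χ₄_nat_one_mod_four h, one_mul, ← h3,
      legendreSym.quadratic_reciprocity_one_mod_four h (by norm_num)]
  · rw [ZMod.χ₄_nat_three_mod_four h, ← h3,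
      legendreSym.quadratic_reciprocity_three_mod_four (p := 3) (by norm_num) h]
    ring

theorem mod_three_eq_two_of_legendreSym_neg_three {p : ℕ} [Fact p.Prime] (hp : p ≠ 2)
    (hp3 : p ≠ 3) (h : legendreSym p (-3) ≠ 1) : p % 3 = 2 := by
  rw [legendreSym_neg_three hp] at h
  have h0 : p % 3 ≠ 0 := fun h0 =>
    hp3 ((Nat.prime_dvd_prime_iff_eq Nat.prime_three Fact.out).1 (Nat.dvd_of_mod_eq_zero h0)).symm
  have h1 : p % 3 ≠ 1 := fun h1 => h (by
    rw [legendreSym.mod, ← Int.natCast_mod, h1]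
    exact legendreSym.at_one 3)
  omega

theorem not_anisotropicNormForm_of_mod_four {F : Type*} [Field F] [CharZero F] {s : F}
    (hs : s ^ 2 = -3) {p q : ℕ} [Fact p.Prime] [Fact q.Prime] (hp : p % 4 = 1) (hq2 : q ≠ 2)
    (hq3 : q ≠ 3) (hpq : legendreSym q p = -1) (hqp : legendreSym p q = -1)
    (hp' : legendreSym p (-3) ≠ 1) (hq' : legendreSym q (-3) ≠ 1) :
    ¬ AnisotropicNormForm (p : F) (q : F) := by
  intro h
  have hpP : p.Prime := Fact.out
  have hqP : q.Prime := Fact.out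
  have hp2 : p ≠ 2 := by rintro rfl; omega
  have hp3 : p ≠ 3 := by rintro rfl; omega
  have hne : p ≠ q := by
    rintro rfl
    rw [(legendreSym.eq_zero_iff p p).2 (by simp)] at hpq
    norm_num at hpq
  have h3 : ∀ {l : ℕ} [Fact l.Prime], l ≠ 3 → (3 : ZMod l) ≠ 0 := by
    intro l _ hl h0
    exact hl ((Nat.prime_dvd_prime_iff_eq Fact.out Nat.prime_three).1
      ((ZMod.natCast_eq_zero_iff 3 l).1 (by exact_mod_cast h0)))
  have h3p := h3 hp3
  have h3q := h3 hq3
  have hp1 : legendreSym p (-3) = -1 :=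
    (legendreSym.eq_one_or_neg_one p (by push_cast; simpa using h3p)).resolve_left hp'
  have hq1 : legendreSym q (-3) = -1 :=
    (legendreSym.eq_one_or_neg_one q (by push_cast; simpa using h3q)).resolve_left hq'
  have hr : ∃ r : ℤ, (q : ℤ) ∣ 3 * r ^ 2 + p := by
    have h1 : legendreSym q (-3 * p) = 1 := by rw [legendreSym.mul, hq1, hpq]; norm_num
    obtain ⟨v, hv⟩ := (legendreSym.eq_one_iff q (by
      intro h0; rw [(legendreSym.eq_zero_iff q _).2 h0] at h1; norm_num at h1)).1 h1
    obtain ⟨r, hr⟩ := ZMod.intCast_surjective (v / 3)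
    refine ⟨r, ?_⟩
    rw [← ZMod.intCast_zmod_eq_zero_iff_dvd _ q]
    push_cast at hv ⊢
    rw [hr]
    field_simp
    linear_combination -hv
  have hs' : ∃ s : ℤ, (p : ℤ) ∣ 3 * s ^ 2 - q := by
    -- Since `p ≡ 1` mod 4, `-1` is a square mod `p`, so 3 is a nonresidue along with `-3`.
    have h1 : legendreSym p (3 * q) = 1 := by
      rw [legendreSym.at_neg hp2, ZMod.χ₄_nat_one_mod_four hp, one_mul] at hp1
      rw [legendreSym.mul, hp1, hqp]; norm_num
    obtain ⟨v, hv⟩ := (legendreSym.eq_one_iff p (by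
      intro h0; rw [(legendreSym.eq_zero_iff p _).2 h0] at h1; norm_num at h1)).1 h1
    obtain ⟨r, hr⟩ := ZMod.intCast_surjective (v / 3)
    refine ⟨r, ?_⟩
    rw [← ZMod.intCast_zmod_eq_zero_iff_dvd _ p]
    push_cast at hv ⊢
    rw [hr]
    field_simp
    linear_combination -hv
  obtain ⟨r, hr⟩ := hr
  obtain ⟨t, ht⟩ := hs'
  have hmod : (3 : ℤ) ∣ p - q := by
    have := mod_three_eq_two_of_legendreSym_neg_three hp2 hp3 hp'
    have := mod_three_eq_two_of_legendreSym_neg_three hq2 hq3 hq'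
    omega
  obtain ⟨x, y, z, hxyz, heq⟩ := exists_three_mul_sq_add_mul_sq_eq hpP hqP hne hp3 hq3 hr ht hmod
  obtain ⟨u, v, huv⟩ := Nat.Prime.sq_add_sq (p := p) (by omega)
  have huvF : (u : F) ^ 2 + v ^ 2 = p := by exact_mod_cast congrArg (Nat.cast : ℕ → F) huv
  have heqF : 3 * (x : F) ^ 2 + p * y ^ 2 = q * z ^ 2 := by
    exact_mod_cast congrArg (Int.cast : ℤ → F) heq
  have hv0 : (v : F) ≠ 0 := fun h0 => h.ne_sq (u : F) (by rw [← huvF, h0]; ring)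
  -- The conic says that `sx + y√p` has norm `-qz²`. Since `p = u² + v²`, `u + √p` has norm `-v²`,
  -- so the product has norm `q(vz)²`.
  obtain ⟨-, -, hvz, -⟩ := h (u * s * x + p * y) (u * y + s * x) (v * z) 0 (by
    linear_combination (v : F) ^ 2 * heqF + (s ^ 2 * x ^ 2 - p * y ^ 2) * huvF
      - (v : F) ^ 2 * x ^ 2 * hs)
  have hz : z = 0 := by exact_mod_cast (mul_eq_zero.1 hvz).resolve_left hv0
  have hp0 : (0 : ℤ) < p := by exact_mod_cast hpP.pos
  subst hz
  have hx2 := sq_nonneg x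
  have hy2 := mul_nonneg hp0.le (sq_nonneg y)
  have hx : x = 0 := by
    rw [← pow_eq_zero_iff two_ne_zero]
    linarith
  have hy : y = 0 := by
    rw [← pow_eq_zero_iff two_ne_zero]
    refine (mul_eq_zero.1 (?_ : (p : ℤ) * y ^ 2 = 0)).resolve_left hp0.ne'
    linarith
  simp [hx, hy] at hxyz

theorem not_anisotropicNormForm_three {F : Type*} [Field F] [CharZero F] {s : F}
    (hs : s ^ 2 = -3) {q : ℕ} [Fact q.Prime] (hq : q % 4 = 1) :
    ¬ AnisotropicNormForm (3 : F) (q : F) := by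
  intro h
  obtain ⟨u, v, huv⟩ := Nat.Prime.sq_add_sq (p := q) (by omega)
  have huvF : (u : F) ^ 2 + v ^ 2 = q := by exact_mod_cast congrArg (Nat.cast : ℕ → F) huv
  have hs0 : s ≠ 0 := by
    rintro rfl
    norm_num at hs
  refine one_ne_zero (h u (v / s) 1 0 ?_).2.2.1
  field_simp
  rw [hs]
  linear_combination -3 * huvF

/-! ### Anisotropy over `ℚ(ε)` and the main theorem. -/

theorem anisotropicNormForm_of_legendreSym {L : Type*} [Field L] [CharZero L] {ε : L}
    (hε : IsPrimitiveRoot ε 3) {p q : ℕ} [Fact p.Prime] (hp : p ≠ 2)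
    (hqp : legendreSym p q = -1) (h3 : legendreSym p (-3) = 1) :
    AnisotropicNormForm (p : ℚ⟮ε⟯) (q : ℚ⟮ε⟯) := by
  obtain ⟨s, hs⟩ := PadicInt.exists_sq_eq_intCast hp h3
  obtain ⟨f⟩ := exists_ringHom_adjoin_primitiveRoot_three (E := ℚ_[p]) hε (s := s)
    (by exact_mod_cast congrArg (Subtype.val : ℤ_[p] → ℚ_[p]) hs)
  refine .of_map f ?_
  rw [map_natCast, map_natCast]
  exact Padic.anisotropicNormForm ((legendreSym.eq_neg_one_iff' p).1 hqp)

theorem mainTheorem5 {L : Type*} [Field L] [CharZero L]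
    (ε : L) (hε : IsPrimitiveRoot ε 3)
    (α : ℤ) (hα0 : α ≠ 0) (hα1 : α ≠ 1) (hα : IsCubeFree α)
    (θ : L) (hθ : θ ^ 3 = (α : L))
    (p q : ℕ) [Fact p.Prime] [Fact q.Prime] (hp : p ≠ 2) (hq : q ≠ 2) (hpq : p ≠ q)
    (hres : legendreSym q (p : ℤ) = -1) (hmod : p ≡ 1 [MOD 4] ∨ q ≡ 1 [MOD 4]) :
    IsDivisionAlgebra ℍ[↥(ℚ⟮ε⟯⟮θ⟯), (p : ↥(ℚ⟮ε⟯⟮θ⟯)), (q : ↥(ℚ⟮ε⟯⟮θ⟯))] ↔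
      (legendreSym p (-3) = 1 ∨ legendreSym q (-3) = 1) := by
  have hres' : legendreSym p (q : ℤ) = -1 := by
    rcases hmod with h | h
    · rwa [← legendreSym.quadratic_reciprocity_one_mod_four h hq]
    · rwa [legendreSym.quadratic_reciprocity_one_mod_four h hp]
  have hεF : IsPrimitiveRoot (IntermediateField.AdjoinSimple.gen ℚ ε) 3 :=
    .of_map_of_injective (f := algebraMap ℚ⟮ε⟯ L) (by simpa using hε) (algebraMap ℚ⟮ε⟯ L).injective
  rw [isDivisionAlgebra_quaternionAlgebra_iff]
  constructor
  · intro h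
    by_contra! hcon
    have hgeom := hεF.geom_sum_eq_zero (by norm_num)
    simp only [Finset.sum_range_succ, Finset.sum_range_zero] at hgeom
    -- `2ε + 1` is a square root of `-3`.
    have hs : (algebraMap ℚ⟮ε⟯ ℚ⟮ε⟯⟮θ⟯ (2 * IntermediateField.AdjoinSimple.gen ℚ ε + 1)) ^ 2 = -3 := by
      rw [← map_pow, show (2 * IntermediateField.AdjoinSimple.gen ℚ ε + 1) ^ 2 = -3 by
        linear_combination 4 * hgeom]
      rw [map_neg, map_ofNat]
    have hmod' : p % 4 = 1 ∨ q % 4 = 1 := hmod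
    by_cases hp3 : p = 3
    · subst hp3
      exact not_anisotropicNormForm_three hs (by omega : q % 4 = 1) (by exact_mod_cast h)
    by_cases hq3 : q = 3
    · subst hq3
      exact not_anisotropicNormForm_three hs (by omega : p % 4 = 1) (by exact_mod_cast h.symm)
    rcases hmod' with h4 | h4
    · exact not_anisotropicNormForm_of_mod_four hs h4 hq hq3 hres hres' hcon.1 hcon.2 h
    · exact not_anisotropicNormForm_of_mod_four hs h4 hp hp3 hres' hres hcon.2 hcon.1 h.symm
  · intro h
    have hF : AnisotropicNormForm (p : ℚ⟮ε⟯) (q : ℚ⟮ε⟯) := by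
      rcases h with h | h
      · exact anisotropicNormForm_of_legendreSym hε hp hres' h
      · exact (anisotropicNormForm_of_legendreSym hε hq hres h).symm
    have := hF.of_odd_finrank (odd_finrank_adjoin_of_cube_mem (L := L) (a := (α : ℚ⟮ε⟯)) hεF
      (by rw [hθ, map_intCast]))
      (by exact_mod_cast (Fact.out : p.Prime).ne_zero)
      (by exact_mod_cast (Fact.out : q.Prime).ne_zero)
    simpa only [map_natCast] using this
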